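/- **Setting.** Let $(\Lambda,d)$ be a metric space and assign to each $x\in\Lambda$ a non-zero finite-dimensional Hilbert space $\mathcal H_x$. For finite $X\subset\Lambda$ let $\mathcal A_X=\mathcal B(\bigotimes_{x\in X}\mathcal H_x)$, and let $\mathcal A$ be the quasi-local C*-algebra, the norm completion of $\bigcup_X\mathcal A_X$. Let $F:[0,\infty)\to(0,\infty)$ be non-increasing with $$\|F\|:=\sup_{x}\sum_{y}F(d(x,y))<\infty,\qquad C:=\sup_{x,y}\sum_{z}\frac{F(d(x,z))F(d(z,y))}{F(d(x,y))}<\infty .$$ For $a\ge 0$ put $F_a(r)=e^{-ar}F(r)$ and let $\|F_a\|$, $C_a$ be the same quantities for $F_a$. An interaction assigns to each finite $X\subset\Lambda$ a self-adjoint $\Phi(X)\in\mathcal A_X$; it belongs to $\mathcal B_a(\Lambda)$ if $$\|\Phi\|_a:=\sup_{x,y\in\Lambda}\ \sum_{X\ni x,y}\frac{\|\Phi(X)\|}{F_a(d(x,y))}<\infty .$$ For finite $V\subset\Lambda$ let $H_V=\sum_{X\subset V}\Phi(X)$ and $\tau^V_t(O)=e^{itH_V}Oe^{-itH_V}$. A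 product state is a state $\langle\cdot\rangle$ on $\mathcal A$ with $\langle\bigotimes_{x\in X}m_x\rangle=\prod_{x\in X}\Omega_x(m_x)$ for all finite $X$, where each $\Omega_x$ is a (not necessarily pure) state on $\mathcal B(\mathcal H_x)$. Write $d(X,Y)=\min_{x\in X,y\in Y}d(x,y)$ for finite non-empty $X,Y$. **Theorem 3.1.** Let $a\ge0$, $\Phi\in\mathcal B_a(\Lambda)$, and let $\langle\cdot\rangle$ be a product state. For every $O\in\mathcal A$ and $t\in\mathbb R$ the limit $\tau_t(O)=\lim_V\tau_t^V(O)$ along the finite subsets of $\Lambda$ exists in norm. For all finite non-empty $X,Y\subset\Lambda$ with $d(X,Y)>0$, all $A\in\mathcal A_X$, $B\in\mathcal A_Y$ and all $t\in\mathbb R$, $$\big|\langle\tau_t(AB)\rangle-\langle\tau_t(A)\rangle\langle\tau_t(B)\rangle\big|\le 4\|A\|\|B\|\,G_a(t)\Big(\sum_{x\in X}\ \sum_{y\in\Lambda:\,2d(x,y)\ge d(X,Y)}F_a(d(x,y))+\sum_{y\in Y}\ \sum_{x\in\Lambda:\,2d(x,y)\ge d(X,Y)}F_a(d(x,y))\Big),$$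 and moreover $$\big|\langle\tau_t(AB)\rangle-\langle\tau_t(A)\rangle\langle\tau_t(B)\rangle\big|\le 4\|A\|\|B\|\,\|F\|\,(|X|+|Y|)\,G_a(t)\,e^{-a\,d(X,Y)/2},$$ where $$G_a(t)=\frac{C_a+\|F_a\|}{C_a}\,\|\Phi\|_a\int_0^{|t|}e^{2\|\Phi\|_aC_as}\,ds .$$ -/

import Mathlib

open scoped BigOperators ENNReal ComplexOrder
open Filter Topology

noncomputable section

namespace SpinLattice

universe u v

variable {Λ : Type u} (ι : Λ → Type v)

/-- Configurations on the finite set `X`.  They label the product basis of the Hilbert space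
`⊗_{x ∈ X} ℂ^{ι x}`. -/
abbrev LocalConfig (X : Finset Λ) : Type (max u v) := (x : X) → ι x

/-- The Hilbert space of square-summable functions of the configurations of the whole lattice.
It only serves to represent all local observable algebras faithfully and compatibly. -/
abbrev ConfigSpace : Type (max u v) := lp (fun _ : ((x : Λ) → ι x) => ℂ) 2

variable {ι} [DecidableEq Λ]

/-- Restriction of a configuration to `X`. -/
def restr (X : Finset Λ) (σ : (x : Λ) → ι x) : LocalConfig ι X := fun x => σ x

/-- The configuration that equals `η` on `X` and `σ` outside `X`. -/
def glue (X : Finset Λ) (σ : (x : Λ) → ι x) (η : LocalConfig ι X) : (x : Λ) → ι x :=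
  fun x => if h : x ∈ X then η ⟨x, h⟩ else σ x

theorem restr_glue (X : Finset Λ) (σ : (x : Λ) → ι x) (η : LocalConfig ι X) :
    restr X (glue X σ η) = η := by
  funext x
  simp [restr, glue]

theorem glue_glue (X : Finset Λ) (σ : (x : Λ) → ι x) (η ζ : LocalConfig ι X) :
    glue X (glue X σ η) ζ = glue X σ ζ := by
  funext x
  by_cases h : x ∈ X <;> simp [glue, h]

theorem glue_restr (X : Finset Λ) (σ : (x : Λ) → ι x) : glue X σ (restr X σ) = σ := by
  funext x
  by_cases h : x ∈ X <;> simp [glue, restr, h]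

theorem glue_of_restr {X : Finset Λ} {σ : (x : Λ) → ι x} {b : LocalConfig ι X}
    (h : restr X σ = b) : glue X σ b = σ := by
  rw [← h, glue_restr]

open Classical in
theorem unit_sum_le (X : Finset Λ) (a b : LocalConfig ι X) (ψ : ConfigSpace ι)
    (s : Finset ((x : Λ) → ι x)) :
    ∑ σ ∈ s, ‖(if restr X σ = a then ψ (glue X σ b) else 0 : ℂ)‖ ^ (2 : ℝ≥0∞).toReal
      ≤ ‖ψ‖ ^ (2 : ℝ≥0∞).toReal := by
  have h2 : (0 : ℝ) < (2 : ℝ≥0∞).toReal := by norm_num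
  have h1 : ∑ σ ∈ s, ‖(if restr X σ = a then ψ (glue X σ b) else 0 : ℂ)‖ ^ (2 : ℝ≥0∞).toReal
      = ∑ σ ∈ s.filter (fun σ => restr X σ = a), ‖ψ (glue X σ b)‖ ^ (2 : ℝ≥0∞).toReal := by
    rw [Finset.sum_filter]
    refine Finset.sum_congr rfl fun σ _ => ?_
    by_cases h : restr X σ = a <;> simp [h]
  have hinj : Set.InjOn (fun σ => glue X σ b)
      (s.filter (fun σ => restr X σ = a) : Finset ((x : Λ) → ι x)) := by
    intro σ hσ σ' hσ' h
    simp only [Finset.coe_filter, Set.mem_ofPred_eq] at hσ hσ'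
    have := congrArg (fun τ => glue X τ a) h
    simp only [glue_glue] at this
    rw [← glue_restr X σ, ← glue_restr X σ', hσ.2, hσ'.2]
    exact this
  rw [h1, ← Finset.sum_image (f := fun σ => ‖ψ σ‖ ^ (2 : ℝ≥0∞).toReal) hinj]
  exact lp.sum_rpow_le_norm_rpow h2 ψ _

open Classical in
/-- The operator of the matrix unit `|a⟩⟨b|` on `X`, tensored with the identity outside `X`. -/
def unitOp (X : Finset Λ) (a b : LocalConfig ι X) : ConfigSpace ι →L[ℂ] ConfigSpace ι :=
  LinearMap.mkContinuous
    { toFun := fun ψ =>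
        ⟨fun σ => if restr X σ = a then ψ (glue X σ b) else 0,
          memℓp_gen' (unit_sum_le X a b ψ)⟩
      map_add' := fun ψ φ => by
        ext σ
        change (if restr X σ = a then (ψ + φ) (glue X σ b) else 0) =
          (if restr X σ = a then ψ (glue X σ b) else 0) +
            (if restr X σ = a then φ (glue X σ b) else 0)
        by_cases h : restr X σ = a <;> simp [h]
      map_smul' := fun c ψ => by
        ext σ
        by_cases h : restr X σ = a <;> simp [h] }
    1 (fun ψ => by
      rw [one_mul]
      exact lp.norm_le_of_forall_sum_le (by norm_num) (norm_nonneg _) (unit_sum_le X a b ψ))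

open Classical in
theorem unitOp_apply (X : Finset Λ) (a b : LocalConfig ι X) (ψ : ConfigSpace ι)
    (σ : (x : Λ) → ι x) :
    unitOp X a b ψ σ = if restr X σ = a then ψ (glue X σ b) else 0 := rfl

theorem star_unitOp (X : Finset Λ) (a b : LocalConfig ι X) :
    star (unitOp X a b) = unitOp X b a := by
  classical
  rw [ContinuousLinearMap.star_eq_adjoint]
  symm
  rw [ContinuousLinearMap.eq_adjoint_iff]
  intro φ ψ
  rw [lp.inner_eq_tsum, lp.inner_eq_tsum]
  let f : ((x : Λ) → ι x) → ℂ := fun σ => inner ℂ ((unitOp X b a φ) σ) (ψ σ)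
  let g : ((x : Λ) → ι x) → ℂ := fun σ => inner ℂ (φ σ) ((unitOp X a b ψ) σ)
  change ∑' σ, f σ = ∑' σ, g σ
  have hf : Function.support f ⊆ {σ | restr X σ = b} := by
    intro σ hσ
    by_contra h
    exact hσ (by simp only [Set.mem_ofPred_eq] at h; simp [f, unitOp_apply, h])
  have hg : Function.support g ⊆ {σ | restr X σ = a} := by
    intro σ hσ
    by_contra h
    exact hσ (by simp only [Set.mem_ofPred_eq] at h; simp [g, unitOp_apply, h])
  rw [← tsum_subtype_eq_of_support_subset hf, ← tsum_subtype_eq_of_support_subset hg]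
  let e : {σ : (x : Λ) → ι x | restr X σ = b} ≃ {σ : (x : Λ) → ι x | restr X σ = a} :=
    { toFun := fun σ => ⟨glue X σ.1 a, restr_glue X _ _⟩
      invFun := fun σ => ⟨glue X σ.1 b, restr_glue X _ _⟩
      left_inv := fun σ => by
        apply Subtype.ext
        have := σ.2
        simp only [Set.mem_ofPred_eq] at this
        change glue X (glue X σ.1 a) b = σ.1
        rw [glue_glue]
        exact glue_of_restr this
      right_inv := fun σ => by
        apply Subtype.ext
        have := σ.2
        simp only [Set.mem_ofPred_eq] at this
        change glue X (glue X σ.1 b) a = σ.1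
        rw [glue_glue]
        exact glue_of_restr this }
  rw [← e.tsum_eq]
  refine tsum_congr fun σ => ?_
  have hσ : restr X σ.1 = b := σ.2
  have hback : glue X (glue X σ.1 a) b = σ.1 := by
    rw [glue_glue]
    exact glue_of_restr hσ
  simp [f, g, e, unitOp_apply, hσ, restr_glue, hback]

variable [∀ x, Fintype (ι x)]

/-- The matrix `M`, an element of `B(⊗_{x ∈ X} ℂ^{ι x})`, as the operator `M ⊗ 1`. -/
def localOp (X : Finset Λ) (M : Matrix (LocalConfig ι X) (LocalConfig ι X) ℂ) :
    ConfigSpace ι →L[ℂ] ConfigSpace ι :=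
  ∑ a, ∑ b, M a b • unitOp X a b

theorem localOp_apply (X : Finset Λ) (M : Matrix (LocalConfig ι X) (LocalConfig ι X) ℂ)
    (ψ : ConfigSpace ι) (σ : (x : Λ) → ι x) :
    localOp X M ψ σ = ∑ b, M (restr X σ) b * ψ (glue X σ b) := by
  classical
  have h : localOp X M ψ σ = ∑ a, ∑ b, M a b * unitOp X a b ψ σ := by
    let ev : ConfigSpace ι →+ ℂ :=
      { toFun := fun f => f σ, map_zero' := rfl, map_add' := fun _ _ => rfl }
    change ev (localOp X M ψ) = ∑ a, ∑ b, M a b * ev (unitOp X a b ψ)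
    simp only [localOp, sum_apply, map_sum]
    rfl
  rw [h, Finset.sum_eq_single (restr X σ)]
  · exact Finset.sum_congr rfl fun b _ => by rw [unitOp_apply, if_pos rfl]
  · intro a _ ha
    refine Finset.sum_eq_zero fun b _ => ?_
    rw [unitOp_apply, if_neg (Ne.symm ha), mul_zero]
  · intro h
    exact absurd (Finset.mem_univ _) h

variable [∀ x, DecidableEq (ι x)]

/-- The unital `*`-homomorphism `M ↦ M ⊗ 1` on `B(⊗_{x ∈ X} ℂ^{ι x})`. -/
def localRep (X : Finset Λ) :
    Matrix (LocalConfig ι X) (LocalConfig ι X) ℂ →⋆ₐ[ℂ]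
      (ConfigSpace ι →L[ℂ] ConfigSpace ι) where
  toFun := localOp X
  map_one' := by
    ext ψ σ
    rw [localOp_apply]
    simp [Matrix.one_apply, glue_restr]
  map_mul' M N := by
    ext ψ σ
    rw [mul_apply_eq_comp, localOp_apply, localOp_apply]
    simp only [localOp_apply, restr_glue, glue_glue, Matrix.mul_apply, Finset.sum_mul,
      Finset.mul_sum]
    rw [Finset.sum_comm]
    simp only [mul_assoc]
  map_zero' := by
    ext ψ σ
    rw [localOp_apply]
    simp
  map_add' M N := by
    ext ψ σ
    rw [add_apply, lp.coeFn_add, Pi.add_apply]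
    simp only [localOp_apply, Matrix.add_apply, add_mul, Finset.sum_add_distrib]
  commutes' c := by
    ext ψ σ
    rw [localOp_apply]
    simp [Algebra.algebraMap_eq_smul_one, Matrix.one_apply, glue_restr]
  map_star' M := by
    simp only [localOp, star_sum, star_smul, star_unitOp]
    rw [Finset.sum_comm]
    rfl

variable (ι) in
/-- The C*-algebra of all observables: the norm closure of the union (an increasing union of
`*`-algebras, hence equal to the supremum) of the local algebras. -/
def quasiLocal : StarSubalgebra ℂ (ConfigSpace ι →L[ℂ] ConfigSpace ι) :=
  (⨆ X : Finset Λ, (localRep (ι := ι) X).range).topologicalClosure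

variable (ι) in
/-- The algebra of observables, as a type. -/
def Obs : Type (max u v) := quasiLocal ι

instance : CStarAlgebra (Obs ι) :=
  haveI : IsClosed (quasiLocal ι : Set (ConfigSpace ι →L[ℂ] ConfigSpace ι)) :=
    StarSubalgebra.isClosed_topologicalClosure _
  inferInstanceAs (CStarAlgebra (quasiLocal ι))

/-- The embedding of `B(⊗_{x ∈ X} ℂ^{ι x})` into the algebra of observables. -/
def embed (X : Finset Λ) : Matrix (LocalConfig ι X) (LocalConfig ι X) ℂ →⋆ₐ[ℂ] Obs ι :=
  StarAlgHom.codRestrict (localRep X) (quasiLocal ι) fun M =>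
    StarSubalgebra.le_topologicalClosure _
      ((le_iSup (fun X : Finset Λ => (localRep (ι := ι) X).range) X) ⟨M, rfl⟩)

variable (ι) in
/-- The observables supported in the finite set `X`. -/
def localAlg (X : Finset Λ) : StarSubalgebra ℂ (Obs ι) := (embed X).range

variable (ι) in
/-- An interaction: a self-adjoint element of the local algebra of `X` for every finite `X`. -/
structure Interaction where
  toFun : Finset Λ → Obs ι
  mem_localAlg : ∀ X, toFun X ∈ localAlg ι X
  isSelfAdjoint : ∀ X, IsSelfAdjoint (toFun X)

/-- The Hamiltonian of the finite volume `V`. -/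
def Interaction.hamiltonian (Φ : Interaction ι) (V : Finset Λ) : Obs ι :=
  ∑ X ∈ V.powerset, Φ.toFun X

/-- The finite-volume dynamics `exp(itH) A exp(-itH)`. -/
def Interaction.finDynamics (Φ : Interaction ι) (V : Finset Λ) (t : ℝ) (A : Obs ι) : Obs ι :=
  NormedSpace.exp ((Complex.I * (t : ℂ)) • Φ.hamiltonian V) * A *
    NormedSpace.exp (-((Complex.I * (t : ℂ)) • Φ.hamiltonian V))

/-- The dynamics: the norm limit of the finite-volume dynamics along the net of all finite
volumes.  (For a finite lattice this is the dynamics of the full Hamiltonian.) -/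
def Interaction.dynamics (Φ : Interaction ι) (t : ℝ) (A : Obs ι) : Obs ι :=
  limUnder atTop (fun V : Finset Λ => Φ.finDynamics V t A)

/-- A state: a normalized positive linear functional. -/
def IsState {A : Type*} [Ring A] [StarRing A] [Algebra ℂ A] (ω : A →ₗ[ℂ] ℂ) : Prop :=
  ω 1 = 1 ∧ ∀ a : A, 0 ≤ ω (star a * a)

/-- The matrix of the tensor product `⊗_{x ∈ X} m x`. -/
def tensorMatrix (X : Finset Λ) (m : (x : Λ) → Matrix (ι x) (ι x) ℂ) :
    Matrix (LocalConfig ι X) (LocalConfig ι X) ℂ :=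
  Matrix.of fun a b => ∏ x : X, m x (a x) (b x)

/-- `ω` is the product of the single-site states `Ω x`. -/
def IsProductState (Ω : (x : Λ) → Matrix (ι x) (ι x) ℂ →ₗ[ℂ] ℂ) (ω : Obs ι →ₗ[ℂ] ℂ) : Prop :=
  (∀ x, IsState (Ω x)) ∧ IsState ω ∧
    ∀ (X : Finset Λ) (m : (x : Λ) → Matrix (ι x) (ι x) ℂ),
      ω (embed X (tensorMatrix X m)) = ∏ x ∈ X, Ω x (m x)

/-- `F_a(r) = e^{-ar} F(r)`. -/
def expWeight (F : ℝ → ℝ) (a r : ℝ) : ℝ := Real.exp (-(a * r)) * F r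

section Metric

variable [MetricSpace Λ]

variable (Λ) in
/-- `‖F‖ = sup_x ∑_y F(d(x,y))`. -/
def weightNorm (F : ℝ → ℝ) : ℝ≥0∞ := ⨆ x : Λ, ∑' y : Λ, ENNReal.ofReal (F (dist x y))

variable (Λ) in
/-- `C = sup_{x,y} ∑_z F(d(x,z)) F(d(z,y)) / F(d(x,y))`. -/
def weightConv (F : ℝ → ℝ) : ℝ≥0∞ :=
  ⨆ (x : Λ) (y : Λ), ∑' z : Λ, ENNReal.ofReal (F (dist x z) * F (dist z y) / F (dist x y))

variable (Λ) in
/-- `F` is a positive non-increasing function on `[0,∞)` with `‖F‖ < ∞` and `C < ∞`. -/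
structure IsWeight (F : ℝ → ℝ) : Prop where
  antitoneOn : AntitoneOn F (Set.Ici 0)
  pos : ∀ r, 0 ≤ r → 0 < F r
  norm_lt_top : weightNorm Λ F < ∞
  conv_lt_top : weightConv Λ F < ∞

/-- `‖Φ‖_a = sup_{x,y} ∑_{X ∋ x,y} ‖Φ(X)‖ / F_a(d(x,y))`. -/
def Interaction.decayNorm (Φ : Interaction ι) (F : ℝ → ℝ) (a : ℝ) : ℝ≥0∞ :=
  ⨆ (x : Λ) (y : Λ), ∑' X : {X : Finset Λ // x ∈ X ∧ y ∈ X},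
    ENNReal.ofReal (‖Φ.toFun X.1‖ / expWeight F a (dist x y))

/-- `G_a(t) = ((C_a + ‖F_a‖) / C_a) ‖Φ‖_a ∫_0^{|t|} e^{2 ‖Φ‖_a C_a s} ds`. -/
def Interaction.growth (Φ : Interaction ι) (F : ℝ → ℝ) (a t : ℝ) : ℝ :=
  ((weightConv Λ (expWeight F a)).toReal + (weightNorm Λ (expWeight F a)).toReal) /
      (weightConv Λ (expWeight F a)).toReal * (Φ.decayNorm F a).toReal *
    ∫ s in (0 : ℝ)..|t|,
      Real.exp (2 * (Φ.decayNorm F a).toReal * (weightConv Λ (expWeight F a)).toReal * s)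

/-- `d(X,Y) = inf {d(x,y) : x ∈ X, y ∈ Y}`.  If `X` or `Y` is empty, the value is `0`. -/
def setDist (X Y : Finset Λ) : ℝ := sInf {r : ℝ | ∃ x ∈ X, ∃ y ∈ Y, r = dist x y}

end Metric

end SpinLattice

end

/-! Product states factorize over disjoint regions, so it suffices to replace the evolved
observables by ones living in disjoint regions. In a volume V containing X and Y, let U consist of
the points of V at distance less than half of d(X,Y) from X. Then X lies in U and Y in V \ U.
Evolving A with the interactions inside U, and B with those inside V \ U, gives observables of
disjoint support. Only the two replacement errors enter the correlation, and the bound passes to the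
limit over V because it does not depend on V.

The replacement error is controlled by `IsDominated.norm_finDynamics_sub_le`, proved without a
separate Lieb–Robinson bound. The difference D of the two evolutions of A solves D' = i[K, D] + b
with K self-adjoint. The commutator does not change the norm (`norm_le_of_hasDerivAt_commutator`),
so ‖D‖ grows at most at rate ‖b‖. The term b contains the sets Z that meet X and leave U, and
commutators with the same difference taken for Φ(Z) in place of A. The estimate therefore feeds into
itself, and the convolution constant C closes the recursion on S(X) = ∑_{x ∈ X} ∑_{y ∈ V \ U}
f(x,y). The same comparison and summability of the weight give the Cauchy property, hence the
existence of the dynamics. -/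

noncomputable section

namespace SpinLattice

/-! ### Unitary conjugation, norm growth and states in a C*-algebra. -/

section CStar

variable {𝔸 : Type*} [CStarAlgebra 𝔸]

/-- The inner automorphism `exp(itH) A exp(-itH)`. -/
def conjExp (H : 𝔸) (t : ℝ) (A : 𝔸) : 𝔸 :=
  NormedSpace.exp ((Complex.I * (t : ℂ)) • H) * A *
    NormedSpace.exp (-((Complex.I * (t : ℂ)) • H))

theorem exp_mul_exp_neg (x : 𝔸) : NormedSpace.exp x * NormedSpace.exp (-x) = 1 := by
  let +nondep : NormedAlgebra ℚ 𝔸 := .restrictScalars ℚ ℂ 𝔸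
  rw [← NormedSpace.exp_add_of_commute (Commute.neg_right (Commute.refl x)), add_neg_cancel,
    NormedSpace.exp_zero]

theorem exp_neg_mul_exp (x : 𝔸) : NormedSpace.exp (-x) * NormedSpace.exp x = 1 := by
  simpa using exp_mul_exp_neg (-x)

theorem conjExp_mul (H : 𝔸) (t : ℝ) (A B : 𝔸) :
    conjExp H t (A * B) = conjExp H t A * conjExp H t B := by
  simp only [conjExp]
  set U := (Complex.I * (t : ℂ)) • H
  have := exp_neg_mul_exp U
  calc _ = NormedSpace.exp U * A * 1 * B * NormedSpace.exp (-U) := by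
        simp only [mul_assoc, one_mul]
    _ = _ := by rw [← this]; simp only [mul_assoc]

theorem conjExp_sub (H : 𝔸) (t : ℝ) (A B : 𝔸) :
    conjExp H t (A - B) = conjExp H t A - conjExp H t B := by
  simp only [conjExp, mul_sub, sub_mul]

theorem conjExp_sum {α : Type*} (s : Finset α) (H : 𝔸) (t : ℝ) (A : α → 𝔸) :
    conjExp H t (∑ i ∈ s, A i) = ∑ i ∈ s, conjExp H t (A i) := by
  simp only [conjExp, Finset.mul_sum, Finset.sum_mul]

@[simp]
theorem conjExp_zero_time (H A : 𝔸) : conjExp H 0 A = A := by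
  simp [conjExp, NormedSpace.exp_zero]

theorem exp_mem_unitary {H : 𝔸} (hH : IsSelfAdjoint H) (t : ℝ) :
    NormedSpace.exp ((Complex.I * (t : ℂ)) • H) ∈ unitary 𝔸 := by
  let +nondep : NormedAlgebra ℚ 𝔸 := .restrictScalars ℚ ℂ 𝔸
  refine NormedSpace.exp_mem_unitary_of_mem_skewAdjoint (hH.smul_mem_skewAdjoint ?_)
  simp [skewAdjoint.mem_iff]

theorem exp_neg_eq_star {H : 𝔸} (hH : IsSelfAdjoint H) (t : ℝ) :
    NormedSpace.exp (-((Complex.I * (t : ℂ)) • H)) =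
      star (NormedSpace.exp ((Complex.I * (t : ℂ)) • H)) := by
  let +nondep : NormedAlgebra ℚ 𝔸 := .restrictScalars ℚ ℂ 𝔸
  rw [NormedSpace.star_exp]
  simp [hH.star_eq]

theorem norm_conjExp {H : 𝔸} (hH : IsSelfAdjoint H) (t : ℝ) (A : 𝔸) :
    ‖conjExp H t A‖ = ‖A‖ := by
  have hU := exp_mem_unitary hH t
  rw [conjExp, exp_neg_eq_star hH, CStarRing.norm_mul_mem_unitary _ (Unitary.star_mem hU),
    CStarRing.norm_mem_unitary_mul _ hU]

theorem isSelfAdjoint_conjExp {H A : 𝔸} (hH : IsSelfAdjoint H) (hA : IsSelfAdjoint A) (t : ℝ) :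
    IsSelfAdjoint (conjExp H t A) := by
  rw [conjExp, exp_neg_eq_star hH]
  exact hA.conjugate _

theorem conjExp_neg (H : 𝔸) (t : ℝ) (A : 𝔸) : conjExp (-H) t A = conjExp H (-t) A := by
  simp [conjExp]

theorem hasDerivAt_exp_time (H : 𝔸) (t : ℝ) :
    HasDerivAt (fun s : ℝ => NormedSpace.exp ((Complex.I * (s : ℂ)) • H))
      (Complex.I • (NormedSpace.exp ((Complex.I * (t : ℂ)) • H) * H)) t := by
  have h := hasDerivAt_exp_smul_const (𝕂 := ℝ) (Complex.I • H) t
  have e : ∀ s : ℝ, (Complex.I * (s : ℂ)) • H = s • (Complex.I • H) := fun s => by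
    rw [mul_comm, mul_smul, Complex.coe_smul]
  simp only [e]
  simpa using h

theorem hasDerivAt_conjExp (H A : 𝔸) (t : ℝ) :
    HasDerivAt (fun s => conjExp H s A) (Complex.I • conjExp H t (H * A - A * H)) t := by
  have h1 := hasDerivAt_exp_time H t
  have h2 := hasDerivAt_exp_time (-H) t
  have h := (h1.mul_const A).mul h2
  have e : (fun s => conjExp H s A) = (fun s : ℝ => NormedSpace.exp ((Complex.I * (s : ℂ)) • H) * A *
      NormedSpace.exp ((Complex.I * (s : ℂ)) • -H)) := by
    funext s; simp [conjExp]
  have hc : Commute H (NormedSpace.exp (-((Complex.I * (t : ℂ)) • H))) :=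
    (((Commute.refl H).smul_right _).neg_right).exp_right
  rw [e]
  refine h.congr_deriv ?_
  simp only [conjExp, smul_neg, mul_neg, smul_mul_assoc, mul_smul_comm, sub_eq_add_neg]
  rw [← hc.eq]
  simp only [mul_assoc, mul_add, add_mul, smul_add, mul_neg, neg_mul, smul_neg]

/-- The term i[K, D] generates rotations by unitaries, so only b can increase the norm. -/
theorem norm_le_of_hasDerivAt_commutator {D K b : ℝ → 𝔸} {B B' : ℝ → ℝ}
    (hK : ∀ s, IsSelfAdjoint (K s))
    (hD : ∀ s, HasDerivAt D (Complex.I • (K s * D s - D s * K s) + b s) s)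
    (hB : ∀ s, HasDerivAt B (B' s) s) (hb : ∀ s, 0 ≤ s → ‖b s‖ ≤ B' s)
    (h0 : ‖D 0‖ ≤ B 0) {t : ℝ} (ht : 0 ≤ t) : ‖D t‖ ≤ B t := by
  have hcD : Continuous D := continuous_iff_continuousAt.2 fun s => (hD s).continuousAt
  have hcB : Continuous B := continuous_iff_continuousAt.2 fun s => (hB s).continuousAt
  refine image_le_of_liminf_slope_right_le_deriv_boundary (f := fun s => ‖D s‖) (a := 0) (b := t)
    hcD.norm.continuousOn h0 hcB.continuousOn (fun x _ => (hB x).hasDerivWithinAt) ?_ ⟨ht, le_rfl⟩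
  intro x hx r hr
  -- Freezing K at time x avoids a time-ordered propagator: undoing this rotation preserves the norm
  -- and cancels the commutator to first order at x, which is all that a slope bound needs.
  let U : ℝ → 𝔸 := fun s => NormedSpace.exp ((Complex.I * ((s : ℝ) : ℂ)) • K x)
  have hU : HasDerivAt U (Complex.I • K x) 0 := by
    simpa [NormedSpace.exp_zero] using hasDerivAt_exp_time (K x) 0
  have hl : HasDerivAt (fun z : ℝ => U (x - z)) (-(Complex.I • K x)) x := by
    exact HasDerivAt.comp_const_sub x x (by rwa [sub_self])
  have hr' : HasDerivAt (fun z : ℝ => U (z - x)) (Complex.I • K x) x := by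
    exact HasDerivAt.comp_sub_const x x (by rwa [sub_self])
  have hU0 : U 0 = 1 := by simp [U, NormedSpace.exp_zero]
  have hg : HasDerivAt (fun z : ℝ => U (x - z) * D z * U (z - x)) (b x) x := by
    refine ((hl.mul (hD x)).mul hr').congr_deriv ?_
    change (-(Complex.I • K x) * D x + U (x - x) * _) * U (x - x) + U (x - x) * D x * _ = _
    simp only [sub_self, hU0, one_mul, mul_one, neg_mul, smul_mul_assoc, mul_smul_comm, smul_sub]
    abel
  have hn : ∀ z, ‖U (x - z) * D z * U (z - x)‖ = ‖D z‖ := fun z => by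
    rw [CStarRing.norm_mul_mem_unitary _ (exp_mem_unitary (hK x) _),
      CStarRing.norm_mem_unitary_mul _ (exp_mem_unitary (hK x) _)]
  have := (hg.hasDerivWithinAt (s := Set.Ici x)).liminf_right_slope_norm_le
    ((hb x hx.1).trans_lt hr)
  refine this.mono fun z hz => ?_
  rw [hn, hn] at hz
  rwa [slope_def_field, div_eq_inv_mul]

theorem norm_commutator_le (A B : 𝔸) : ‖A * B - B * A‖ ≤ 2 * ‖A‖ * ‖B‖ := by
  have h1 := norm_mul_le A B
  have h2 := norm_mul_le B A
  have := norm_sub_le (A * B) (B * A)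
  linarith [mul_comm ‖A‖ ‖B‖]

/-- Cauchy–Schwarz in the GNS space: ω(A) is the inner product of the unit vector of 1 with the
vector of A, and left multiplication by A has norm at most ‖A‖. -/
theorem IsState.norm_apply_le {ω : 𝔸 →ₗ[ℂ] ℂ} (hω : IsState ω) (A : 𝔸) : ‖ω A‖ ≤ ‖A‖ := by
  let _ : PartialOrder 𝔸 := CStarAlgebra.spectralOrder 𝔸
  have _ : StarOrderedRing 𝔸 := CStarAlgebra.spectralOrderedRing 𝔸
  have hpos : ∀ x : 𝔸, 0 ≤ x → 0 ≤ ω x := fun x hx => by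
    obtain ⟨y, rfl⟩ := CStarAlgebra.nonneg_iff_eq_star_mul_self.1 hx
    exact hω.2 y
  let f : 𝔸 →ₚ[ℂ] ℂ := PositiveLinearMap.mk₀ ω hpos
  have hcs := norm_inner_le_norm (𝕜 := ℂ) (f.toPreGNS 1) (f.toPreGNS A)
  have hf : ∀ x, f x = ω x := fun x => rfl
  have h1 : ‖f.toPreGNS 1‖ = 1 := by
    rw [f.preGNS_norm_def]
    simp [hf, hω.1]
  have h2 : ‖f.toPreGNS A‖ ≤ ‖A‖ := by
    have := (f.leftMulMapPreGNS A).le_opNorm (f.toPreGNS 1)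
    have h3 : ‖f.leftMulMapPreGNS A‖ ≤ ‖A‖ :=
      LinearMap.mkContinuous_norm_le _ (norm_nonneg _) _
    rw [f.leftMulMapPreGNS_apply, h1] at this
    simp at this
    exact this.trans h3
  rw [f.preGNS_inner_def, h1] at hcs
  simp [hf] at hcs
  linarith

end CStar

end SpinLattice

end

/-! ### Local algebras: commutation, inclusion, factorization, density. -/

noncomputable section

namespace SpinLattice

universe u v

variable {Λ : Type u} {ι : Λ → Type v} [DecidableEq Λ]

/-- The configuration on `X ∪ Y` given by `a` on `X` and by `b` on `Y \ X`. -/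
def mergeConfig {X Y : Finset Λ} (a : LocalConfig ι X) (b : LocalConfig ι Y) :
    LocalConfig ι (X ∪ Y) := fun x =>
  if h : x.1 ∈ X then a ⟨x.1, h⟩ else b ⟨x.1, (Finset.mem_union.1 x.2).resolve_left h⟩

theorem restr_eq_mergeConfig_iff {X Y : Finset Λ} (hXY : Disjoint X Y) (a : LocalConfig ι X)
    (c : LocalConfig ι Y) (σ : (x : Λ) → ι x) :
    restr (X ∪ Y) σ = mergeConfig a c ↔ restr X σ = a ∧ restr Y σ = c := by
  constructor
  · intro h
    constructor
    · funext x
      have := congrFun h ⟨x.1, Finset.mem_union_left _ x.2⟩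
      simpa [restr, mergeConfig] using this
    · funext x
      have := congrFun h ⟨x.1, Finset.mem_union_right _ x.2⟩
      have hx : x.1 ∉ X := Finset.disjoint_right.1 hXY x.2
      simpa [restr, mergeConfig, hx] using this
  · rintro ⟨rfl, rfl⟩
    funext x
    by_cases h : x.1 ∈ X <;> simp [restr, mergeConfig, h]

theorem glue_mergeConfig {X Y : Finset Λ} (hXY : Disjoint X Y) (b : LocalConfig ι X)
    (d : LocalConfig ι Y) (σ : (x : Λ) → ι x) :
    glue (X ∪ Y) σ (mergeConfig b d) = glue Y (glue X σ b) d := by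
  funext x
  by_cases hX : x ∈ X
  · have hY : x ∉ Y := Finset.disjoint_left.1 hXY hX
    simp [glue, mergeConfig, hX, hY]
  · by_cases hY : x ∈ Y <;> simp [glue, mergeConfig, hX, hY]

theorem glue_glue_comm {X Y : Finset Λ} (hXY : Disjoint X Y) (b : LocalConfig ι X)
    (d : LocalConfig ι Y) (σ : (x : Λ) → ι x) :
    glue X (glue Y σ d) b = glue Y (glue X σ b) d := by
  funext x
  by_cases hX : x ∈ X
  · have hY : x ∉ Y := Finset.disjoint_left.1 hXY hX
    simp [glue, hX, hY]
  · by_cases hY : x ∈ Y <;> simp [glue, hX, hY]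

theorem restr_glue_of_disjoint {X Y : Finset Λ} (hXY : Disjoint X Y) (b : LocalConfig ι X)
    (σ : (x : Λ) → ι x) : restr Y (glue X σ b) = restr Y σ := by
  funext x
  simp [restr, glue, Finset.disjoint_right.1 hXY x.2]

/-- With its reversed-order companion, this reduces commutation and factorization over disjoint sets
to matrix units. -/
theorem unitOp_mul_unitOp {X Y : Finset Λ} (hXY : Disjoint X Y) (a b : LocalConfig ι X)
    (c d : LocalConfig ι Y) :
    unitOp X a b * unitOp Y c d = unitOp (X ∪ Y) (mergeConfig a c) (mergeConfig b d) := by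
  classical
  ext ψ σ
  rw [mul_apply_eq_comp, unitOp_apply, unitOp_apply, unitOp_apply, restr_glue_of_disjoint hXY,
    glue_mergeConfig hXY]
  simp only [restr_eq_mergeConfig_iff hXY, ite_and]

theorem unitOp_mul_unitOp' {X Y : Finset Λ} (hXY : Disjoint X Y) (a b : LocalConfig ι X)
    (c d : LocalConfig ι Y) :
    unitOp Y c d * unitOp X a b = unitOp (X ∪ Y) (mergeConfig a c) (mergeConfig b d) := by
  classical
  ext ψ σ
  rw [mul_apply_eq_comp, unitOp_apply, unitOp_apply, unitOp_apply, restr_glue_of_disjoint hXY.symm,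
    glue_mergeConfig hXY, glue_glue_comm hXY]
  simp only [restr_eq_mergeConfig_iff hXY, ite_and]
  split_ifs <;> rfl

variable [∀ x, Fintype (ι x)] [∀ x, DecidableEq (ι x)]

theorem localRep_single (X : Finset Λ) (a b : LocalConfig ι X) :
    localRep X (Matrix.single a b 1) = unitOp X a b := by
  classical
  change ∑ a', ∑ b', Matrix.single a b (1 : ℂ) a' b' • unitOp X a' b' = _
  simp [Matrix.single_apply, ite_and]

theorem embed_eq_sum (X : Finset Λ) (M : Matrix (LocalConfig ι X) (LocalConfig ι X) ℂ) :
    embed X M = ∑ a, ∑ b, M a b • embed X (Matrix.single a b 1) := by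
  conv_lhs => rw [Matrix.matrix_eq_sum_single M]
  simp only [map_sum, ← map_smul, Matrix.smul_single, smul_eq_mul, mul_one]

theorem obs_ext {A B : Obs ι}
    (h : (show quasiLocal ι from A).1 = (show quasiLocal ι from B).1) : A = B :=
  Subtype.ext h

theorem embed_single_mul {X Y : Finset Λ} (hXY : Disjoint X Y) (a b : LocalConfig ι X)
    (c d : LocalConfig ι Y) :
    embed X (Matrix.single a b 1) * embed Y (Matrix.single c d 1) =
      embed (X ∪ Y) (Matrix.single (mergeConfig a c) (mergeConfig b d) 1) := by
  refine obs_ext ?_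
  change localRep X (Matrix.single a b 1) * localRep Y (Matrix.single c d 1) = localRep _ _
  rw [localRep_single, localRep_single, localRep_single, unitOp_mul_unitOp hXY]

theorem embed_single_mul' {X Y : Finset Λ} (hXY : Disjoint X Y) (a b : LocalConfig ι X)
    (c d : LocalConfig ι Y) :
    embed Y (Matrix.single c d 1) * embed X (Matrix.single a b 1) =
      embed (X ∪ Y) (Matrix.single (mergeConfig a c) (mergeConfig b d) 1) := by
  refine obs_ext ?_
  change localRep Y (Matrix.single c d 1) * localRep X (Matrix.single a b 1) = localRep _ _
  rw [localRep_single, localRep_single, localRep_single, unitOp_mul_unitOp' hXY]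

theorem commute_of_disjoint {X Y : Finset Λ} (hXY : Disjoint X Y) {A B : Obs ι}
    (hA : A ∈ localAlg ι X) (hB : B ∈ localAlg ι Y) : Commute A B := by
  obtain ⟨M, rfl⟩ := hA
  obtain ⟨N, rfl⟩ := hB
  change Commute (embed X M) (embed Y N)
  rw [embed_eq_sum X M, embed_eq_sum Y N]
  refine Commute.sum_left _ _ _ fun a _ => Commute.sum_left _ _ _ fun b _ =>
    Commute.sum_right _ _ _ fun c _ => Commute.sum_right _ _ _ fun d _ => ?_
  refine Commute.smul_left (Commute.smul_right ?_ _) _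
  exact (embed_single_mul hXY a b c d).trans (embed_single_mul' hXY a b c d).symm

theorem embed_mem_localAlg (X : Finset Λ) (M : Matrix (LocalConfig ι X) (LocalConfig ι X) ℂ) :
    embed X M ∈ localAlg ι X := ⟨M, rfl⟩

theorem localAlg_mono {X V : Finset Λ} (h : X ⊆ V) : localAlg ι X ≤ localAlg ι V := by
  rintro _ ⟨M, rfl⟩
  change embed X M ∈ _
  rw [embed_eq_sum X M]
  refine sum_mem fun a _ => sum_mem fun b _ => SMulMemClass.smul_mem _ ?_
  -- Inserting the diagonal resolution of the identity on V \ X rewrites a matrix unit on X as a sum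
  -- of matrix units on V.
  have h1 : (1 : Obs ι) = ∑ c, embed (V \ X) (Matrix.single c c 1) := by
    rw [← map_sum, Matrix.sum_single_one, map_one]
  rw [← mul_one (embed X _), h1, Finset.mul_sum]
  refine sum_mem fun c _ => ?_
  rw [embed_single_mul Finset.disjoint_sdiff]
  have hV : X ∪ V \ X = V := Finset.union_sdiff_of_subset h
  have := embed_mem_localAlg (X ∪ V \ X) (Matrix.single (mergeConfig a c) (mergeConfig b c) 1)
  rwa [congrArg (localAlg ι) hV] at this

/-- The single-site matrices whose tensor product is the matrix unit `|a⟩⟨b|`. -/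
def siteUnit {X : Finset Λ} (a b : LocalConfig ι X) (x : Λ) : Matrix (ι x) (ι x) ℂ :=
  if h : x ∈ X then Matrix.single (a ⟨x, h⟩) (b ⟨x, h⟩) 1 else 1

omit [∀ x, Fintype (ι x)] in
theorem tensorMatrix_siteUnit {X : Finset Λ} (a b : LocalConfig ι X) :
    tensorMatrix X (siteUnit a b) = Matrix.single a b 1 := by
  ext a' b'
  simp only [tensorMatrix, siteUnit, Matrix.of_apply, Matrix.single_apply, Finset.coe_mem,
    dite_true]
  rw [Finset.prod_ite_zero]
  simp [funext_iff, forall_and]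

theorem IsProductState.map_single {Ω : (x : Λ) → Matrix (ι x) (ι x) ℂ →ₗ[ℂ] ℂ} {ω : Obs ι →ₗ[ℂ] ℂ}
    (hω : IsProductState Ω ω) {X : Finset Λ} (a b : LocalConfig ι X) :
    ω (embed X (Matrix.single a b 1)) = ∏ x ∈ X, Ω x (siteUnit a b x) := by
  rw [← tensorMatrix_siteUnit, hω.2.2]

/-- The hypothesis on ω concerns pure tensors only; matrix units are pure tensors and span, so
bilinearity does the rest. -/
theorem IsProductState.map_mul {Ω : (x : Λ) → Matrix (ι x) (ι x) ℂ →ₗ[ℂ] ℂ} {ω : Obs ι →ₗ[ℂ] ℂ}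
    (hω : IsProductState Ω ω) {X Y : Finset Λ} (hXY : Disjoint X Y) {A B : Obs ι}
    (hA : A ∈ localAlg ι X) (hB : B ∈ localAlg ι Y) : ω (A * B) = ω A * ω B := by
  have key : ∀ (a b : LocalConfig ι X) (c d : LocalConfig ι Y),
      ω (embed X (Matrix.single a b 1) * embed Y (Matrix.single c d 1)) =
        ω (embed X (Matrix.single a b 1)) * ω (embed Y (Matrix.single c d 1)) := by
    intro a b c d
    rw [embed_single_mul hXY, hω.map_single, hω.map_single, hω.map_single,
      Finset.prod_union hXY]
    congr 1
    · refine Finset.prod_congr rfl fun x hx => ?_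
      simp [siteUnit, mergeConfig, hx]
    · refine Finset.prod_congr rfl fun x hx => ?_
      have hX : x ∉ X := Finset.disjoint_right.1 hXY hx
      simp [siteUnit, mergeConfig, hx, hX]
  obtain ⟨M, rfl⟩ := hA
  obtain ⟨N, rfl⟩ := hB
  change ω (embed X M * embed Y N) = ω (embed X M) * ω (embed Y N)
  rw [embed_eq_sum X M, embed_eq_sum Y N]
  simp only [Finset.sum_mul, Finset.mul_sum, map_sum, smul_mul_assoc, mul_smul_comm, map_smul,
    key, smul_eq_mul]
  refine Finset.sum_congr rfl fun _ _ => Finset.sum_congr rfl fun _ _ =>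
    Finset.sum_congr rfl fun _ _ => Finset.sum_congr rfl fun _ _ => ?_
  ring

theorem exists_localAlg_norm_sub_lt (O : Obs ι) {ε : ℝ} (hε : 0 < ε) :
    ∃ X : Finset Λ, ∃ A ∈ localAlg ι X, ‖O - A‖ < ε := by
  -- Directedness makes the supremum in the definition of `quasiLocal` a plain union.
  have hdir : Directed (· ≤ ·) fun X : Finset Λ => (localRep (ι := ι) X).range := by
    have hm : ∀ X V : Finset Λ, X ⊆ V → (localRep (ι := ι) X).range ≤ (localRep (ι := ι) V).range := by
      rintro X V h _ ⟨M, rfl⟩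
      obtain ⟨N, hN⟩ := localAlg_mono h (embed_mem_localAlg X M)
      exact ⟨N, congrArg Subtype.val hN⟩
    exact fun X Y => ⟨X ∪ Y, hm _ _ Finset.subset_union_left, hm _ _ Finset.subset_union_right⟩
  have hO : (show quasiLocal ι from O).1 ∈
      closure ((⨆ X : Finset Λ, (localRep (ι := ι) X).range :
        StarSubalgebra ℂ (ConfigSpace ι →L[ℂ] ConfigSpace ι)) : Set _) :=
    (show quasiLocal ι from O).2
  obtain ⟨A, hA, hd⟩ := Metric.mem_closure_iff.1 hO ε hε
  rw [StarSubalgebra.coe_iSup_of_directed hdir, Set.mem_iUnion] at hA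
  obtain ⟨X, M, rfl⟩ := hA
  refine ⟨X, embed X M, embed_mem_localAlg X M, ?_⟩
  rw [dist_eq_norm] at hd
  exact hd

end SpinLattice

end

/-! ### Comparison of the dynamics in nested finite volumes. -/

noncomputable section

namespace SpinLattice

universe u v

section ExpIntegral

/-- `∫_0^t e^{κ s} ds`. -/
def expIntegral (κ t : ℝ) : ℝ := ∫ s in (0 : ℝ)..t, Real.exp (κ * s)

theorem continuous_exp_const_mul (κ : ℝ) : Continuous fun s : ℝ => Real.exp (κ * s) := by
  fun_prop

theorem hasDerivAt_expIntegral (κ t : ℝ) :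
    HasDerivAt (expIntegral κ) (Real.exp (κ * t)) t :=
  (continuous_exp_const_mul κ).integral_hasStrictDerivAt 0 t |>.hasDerivAt

/-- The integral equation that makes `expIntegral` a fixed point of the recursive estimate below. -/
theorem one_add_mul_expIntegral (κ t : ℝ) : 1 + κ * expIntegral κ t = Real.exp (κ * t) := by
  have h : ∀ s ∈ Set.uIcc 0 t, HasDerivAt (fun r => Real.exp (κ * r)) (κ * Real.exp (κ * s)) s :=
    fun s _ => by
      simpa [mul_comm] using ((hasDerivAt_id s).const_mul κ).exp
  have := intervalIntegral.integral_eq_sub_of_hasDerivAt h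
    (((continuous_exp_const_mul κ).const_mul κ).intervalIntegrable _ _)
  rw [intervalIntegral.integral_const_mul] at this
  rw [expIntegral, this]
  simp

theorem expIntegral_nonneg (κ : ℝ) {t : ℝ} (ht : 0 ≤ t) : 0 ≤ expIntegral κ t :=
  intervalIntegral.integral_nonneg ht fun _ _ => (Real.exp_pos _).le

end ExpIntegral

variable {Λ : Type u} {ι : Λ → Type v} [DecidableEq Λ]
  [∀ x, Fintype (ι x)] [∀ x, DecidableEq (ι x)]

namespace Interaction

theorem isSelfAdjoint_hamiltonian (Φ : Interaction ι) (V : Finset Λ) :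
    IsSelfAdjoint (Φ.hamiltonian V) :=
  isSelfAdjoint_sum _ fun X _ => Φ.isSelfAdjoint X

theorem hamiltonian_mem_localAlg (Φ : Interaction ι) (V : Finset Λ) :
    Φ.hamiltonian V ∈ localAlg ι V :=
  sum_mem fun X hX => localAlg_mono (Finset.mem_powerset.1 hX) (Φ.mem_localAlg X)

theorem finDynamics_eq_conjExp (Φ : Interaction ι) (V : Finset Λ) (t : ℝ) (A : Obs ι) :
    Φ.finDynamics V t A = conjExp (Φ.hamiltonian V) t A := rfl

theorem norm_finDynamics (Φ : Interaction ι) (V : Finset Λ) (t : ℝ) (A : Obs ι) :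
    ‖Φ.finDynamics V t A‖ = ‖A‖ :=
  norm_conjExp (Φ.isSelfAdjoint_hamiltonian V) t A

theorem finDynamics_mul (Φ : Interaction ι) (V : Finset Λ) (t : ℝ) (A B : Obs ι) :
    Φ.finDynamics V t (A * B) = Φ.finDynamics V t A * Φ.finDynamics V t B :=
  conjExp_mul _ _ _ _

theorem finDynamics_sub (Φ : Interaction ι) (V : Finset Λ) (t : ℝ) (A B : Obs ι) :
    Φ.finDynamics V t (A - B) = Φ.finDynamics V t A - Φ.finDynamics V t B :=
  conjExp_sub _ _ _ _

theorem hamiltonian_commutator (Φ : Interaction ι) (V : Finset Λ) {X : Finset Λ} {A : Obs ι}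
    (hA : A ∈ localAlg ι X) :
    Φ.hamiltonian V * A - A * Φ.hamiltonian V =
      ∑ Z ∈ V.powerset with ¬ Disjoint Z X, (Φ.toFun Z * A - A * Φ.toFun Z) := by
  rw [hamiltonian, Finset.sum_mul, Finset.mul_sum, ← Finset.sum_sub_distrib, Finset.sum_filter]
  refine Finset.sum_congr rfl fun Z _ => ?_
  split_ifs with h
  · rw [(commute_of_disjoint h (Φ.mem_localAlg Z) hA).eq, sub_self]
  · rfl

theorem hasDerivAt_finDynamics (Φ : Interaction ι) (V : Finset Λ) {X : Finset Λ} {A : Obs ι}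
    (hA : A ∈ localAlg ι X) (t : ℝ) :
    HasDerivAt (fun s => Φ.finDynamics V s A)
      (Complex.I • ∑ Z ∈ V.powerset with ¬ Disjoint Z X,
        (Φ.finDynamics V t (Φ.toFun Z) * Φ.finDynamics V t A -
          Φ.finDynamics V t A * Φ.finDynamics V t (Φ.toFun Z))) t := by
  refine (hasDerivAt_conjExp (Φ.hamiltonian V) A t).congr_deriv ?_
  rw [Φ.hamiltonian_commutator V hA, conjExp_sum]
  simp only [conjExp_sub, conjExp_mul, finDynamics_eq_conjExp]

/-- For Z inside U, adding and subtracting the mixed product of the V-evolution of Φ(Z) with the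
U-evolution of A isolates a commutator with the difference itself. Sets that leave U occur only in
the V-dynamics. -/
theorem hasDerivAt_finDynamics_sub (Φ : Interaction ι) {V U : Finset Λ} (hUV : U ⊆ V)
    {X : Finset Λ} {A : Obs ι} (hA : A ∈ localAlg ι X) (t : ℝ) :
    HasDerivAt (fun s => Φ.finDynamics V s A - Φ.finDynamics U s A)
      (Complex.I •
        ((∑ Z ∈ U.powerset with ¬ Disjoint Z X, Φ.finDynamics V t (Φ.toFun Z)) *
            (Φ.finDynamics V t A - Φ.finDynamics U t A) -
          (Φ.finDynamics V t A - Φ.finDynamics U t A) *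
            ∑ Z ∈ U.powerset with ¬ Disjoint Z X, Φ.finDynamics V t (Φ.toFun Z)) +
        Complex.I •
          ((∑ Z ∈ U.powerset with ¬ Disjoint Z X,
            ((Φ.finDynamics V t (Φ.toFun Z) - Φ.finDynamics U t (Φ.toFun Z)) *
                Φ.finDynamics U t A -
              Φ.finDynamics U t A *
                (Φ.finDynamics V t (Φ.toFun Z) - Φ.finDynamics U t (Φ.toFun Z)))) +
          ∑ Z ∈ V.powerset with ¬ Disjoint Z X ∧ ¬ Z ⊆ U,
            (Φ.finDynamics V t (Φ.toFun Z) * Φ.finDynamics V t A -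
              Φ.finDynamics V t A * Φ.finDynamics V t (Φ.toFun Z)))) t := by
  refine ((Φ.hasDerivAt_finDynamics V hA t).sub
    (Φ.hasDerivAt_finDynamics U hA t)).congr_deriv ?_
  have hU : {Z ∈ {Z ∈ V.powerset | ¬ Disjoint Z X} | Z ⊆ U} =
      {Z ∈ U.powerset | ¬ Disjoint Z X} := by
    ext Z
    simp only [Finset.mem_filter, Finset.mem_powerset]
    exact ⟨fun h => ⟨h.2, h.1.2⟩, fun h => ⟨⟨h.1.trans hUV, h.2⟩, h.1⟩⟩
  rw [← Finset.sum_filter_add_sum_filter_not {Z ∈ V.powerset | ¬ Disjoint Z X} (· ⊆ U), hU,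
    Finset.filter_filter, ← smul_sub, ← smul_add]
  congr 1
  rw [Finset.sum_mul, Finset.mul_sum, ← Finset.sum_sub_distrib, add_sub_right_comm,
    ← Finset.sum_sub_distrib, ← add_assoc, ← Finset.sum_add_distrib]
  congr 1
  refine Finset.sum_congr rfl fun Z _ => ?_
  noncomm_ring

/-- The interaction is dominated by `N f(x,y)`, summed over any finite family of sets containing
two given points, and `f` is a convolution kernel with constant `C`. -/
structure IsDominated (Φ : Interaction ι) (f : Λ → Λ → ℝ) (N C : ℝ) : Prop where
  nonneg : ∀ x y, 0 ≤ f x y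
  norm_nonneg : 0 ≤ N
  conv_nonneg : 0 ≤ C
  sum_le : ∀ (x y : Λ) (s : Finset (Finset Λ)),
    ∑ Z ∈ s with x ∈ Z ∧ y ∈ Z, ‖Φ.toFun Z‖ ≤ N * f x y
  conv_le : ∀ (x y : Λ) (V : Finset Λ), ∑ z ∈ V, f x z * f z y ≤ C * f x y

variable {Φ : Interaction ι} {f : Λ → Λ → ℝ} {N C : ℝ}

/-- Each Z meets X in some x, so its contribution is charged to the pairs (x, z) in Z × Z.
Exchanging sums leaves, for each pair, the sum that N f(x,z) dominates. -/
theorem IsDominated.sum_norm_mul_le (h : Φ.IsDominated f N C) {V X : Finset Λ}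
    (s : Finset (Finset Λ)) (hs : ∀ Z ∈ s, Z ⊆ V ∧ ¬ Disjoint Z X) (g : Λ → ℝ)
    (hg : ∀ z, 0 ≤ g z) :
    ∑ Z ∈ s, ‖Φ.toFun Z‖ * ∑ z ∈ Z, g z ≤ N * ∑ x ∈ X, ∑ z ∈ V, f x z * g z := by
  calc ∑ Z ∈ s, ‖Φ.toFun Z‖ * ∑ z ∈ Z, g z
      ≤ ∑ Z ∈ s, ∑ x ∈ X, ∑ z ∈ V, (if x ∈ Z ∧ z ∈ Z then ‖Φ.toFun Z‖ else 0) * g z := by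
        refine Finset.sum_le_sum fun Z hZ => ?_
        obtain ⟨x, hxZ, hxX⟩ := Finset.not_disjoint_iff.1 (hs Z hZ).2
        have h0 : ∀ x' z, 0 ≤ (if x' ∈ Z ∧ z ∈ Z then ‖Φ.toFun Z‖ else 0) * g z := fun x' z =>
          mul_nonneg (by split_ifs <;> simp) (hg z)
        refine le_trans ?_ (Finset.single_le_sum (f := fun x' => ∑ z ∈ V,
          (if x' ∈ Z ∧ z ∈ Z then ‖Φ.toFun Z‖ else 0) * g z)
          (fun x' _ => Finset.sum_nonneg fun z _ => h0 x' z) hxX)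
        rw [Finset.mul_sum]
        refine le_trans (le_of_eq ?_) (Finset.sum_le_sum_of_subset_of_nonneg (hs Z hZ).1
          fun z _ _ => h0 x z)
        exact Finset.sum_congr rfl fun z hz => by simp [hxZ, hz]
    _ = ∑ x ∈ X, ∑ z ∈ V, (∑ Z ∈ s with x ∈ Z ∧ z ∈ Z, ‖Φ.toFun Z‖) * g z := by
        rw [Finset.sum_comm]
        refine Finset.sum_congr rfl fun x _ => ?_
        rw [Finset.sum_comm]
        refine Finset.sum_congr rfl fun z _ => ?_
        rw [Finset.sum_filter, Finset.sum_mul]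
    _ ≤ ∑ x ∈ X, ∑ z ∈ V, (N * f x z) * g z :=
        Finset.sum_le_sum fun x _ => Finset.sum_le_sum fun z _ =>
          mul_le_mul_of_nonneg_right (h.sum_le x z s) (hg z)
    _ = _ := by simp only [Finset.mul_sum, mul_assoc]

theorem IsDominated.sum_norm_le (h : Φ.IsDominated f N C) {V U X : Finset Λ} :
    ∑ Z ∈ V.powerset with ¬ Disjoint Z X ∧ ¬ Z ⊆ U, ‖Φ.toFun Z‖ ≤
      N * ∑ x ∈ X, ∑ y ∈ V \ U, f x y := by
  have key := h.sum_norm_mul_le (V := V) (X := X)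
    {Z ∈ V.powerset | ¬ Disjoint Z X ∧ ¬ Z ⊆ U}
    (fun Z hZ => by simp only [Finset.mem_filter, Finset.mem_powerset] at hZ; exact ⟨hZ.1, hZ.2.1⟩)
    -- The indicator of the complement of U has sum at least 1 over any Z that leaves U.
    (fun z => if z ∈ U then 0 else 1) (fun z => by split_ifs <;> simp)
  refine (Finset.sum_le_sum fun Z hZ => ?_).trans (key.trans (le_of_eq ?_))
  · simp only [Finset.mem_filter] at hZ
    obtain ⟨z, hz, hzU⟩ := Finset.not_subset.1 hZ.2.2
    refine le_mul_of_one_le_right (_root_.norm_nonneg _) ?_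
    refine le_trans ?_ (Finset.single_le_sum (f := fun z => if z ∈ U then (0 : ℝ) else 1)
      (fun z _ => by split_ifs <;> simp) hz)
    simp [hzU]
  · congr 1
    refine Finset.sum_congr rfl fun x _ => ?_
    rw [Finset.sdiff_eq_filter, Finset.sum_filter]
    exact Finset.sum_congr rfl fun z _ => by by_cases hz : z ∈ U <;> simp [hz]

theorem IsDominated.sum_norm_mul_sum_le (h : Φ.IsDominated f N C) {V U X : Finset Λ}
    (hUV : U ⊆ V) (W : Finset Λ) :
    ∑ Z ∈ U.powerset with ¬ Disjoint Z X, ‖Φ.toFun Z‖ * ∑ z ∈ Z, ∑ y ∈ W, f z y ≤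
      N * (C * ∑ x ∈ X, ∑ y ∈ W, f x y) := by
  refine (h.sum_norm_mul_le (V := V) (X := X) _ (fun Z hZ => ?_) (fun z => ∑ y ∈ W, f z y)
    fun z => Finset.sum_nonneg fun y _ => h.nonneg z y).trans
    (mul_le_mul_of_nonneg_left ?_ h.norm_nonneg)
  · simp only [Finset.mem_filter, Finset.mem_powerset] at hZ
    exact ⟨hZ.1.trans hUV, hZ.2⟩
  · simp only [Finset.mul_sum]
    refine Finset.sum_le_sum fun x _ => ?_
    rw [Finset.sum_comm]
    exact Finset.sum_le_sum fun y _ => h.conv_le x y V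

/-- Picard iteration from the trivial bound 2‖A‖. The induction covers all X and A at once because
each step applies the hypothesis to Φ(Z) on Z; the factorial remainder depends on V but vanishes as
n grows. -/
theorem IsDominated.norm_finDynamics_sub_le_aux (h : Φ.IsDominated f N C) {V U : Finset Λ}
    (hUV : U ⊆ V) (n : ℕ) : ∀ {X : Finset Λ} {A : Obs ι}, A ∈ localAlg ι X → ∀ {t : ℝ}, 0 ≤ t →
      ‖Φ.finDynamics V t A - Φ.finDynamics U t A‖ ≤
        ‖A‖ * (2 * N * (∑ x ∈ X, ∑ y ∈ V \ U, f x y) * expIntegral (2 * N * C) t +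
          2 * (((2 * ∑ Z ∈ V.powerset, ‖Φ.toFun Z‖) * t) ^ n / n.factorial)) := by
  have hN := h.norm_nonneg
  have hC := h.conv_nonneg
  induction n with
  | zero =>
    intro X A hA t ht
    have h1 := norm_sub_le (Φ.finDynamics V t A) (Φ.finDynamics U t A)
    rw [norm_finDynamics, norm_finDynamics] at h1
    have h2 : 0 ≤ ∑ x ∈ X, ∑ y ∈ V \ U, f x y :=
      Finset.sum_nonneg fun x _ => Finset.sum_nonneg fun y _ => h.nonneg x y
    have h3 := expIntegral_nonneg (2 * N * C) ht
    have h4 : 0 ≤ ‖A‖ * (2 * N * (∑ x ∈ X, ∑ y ∈ V \ U, f x y) * expIntegral (2 * N * C) t) := by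
      positivity
    simp only [pow_zero, Nat.factorial_zero, Nat.cast_one, div_one, mul_one]
    linarith
  | succ n ih =>
    intro X A hA t ht
    set S : Finset Λ → ℝ := fun X => ∑ x ∈ X, ∑ y ∈ V \ U, f x y with hS
    set M := 2 * ∑ Z ∈ V.powerset, ‖Φ.toFun Z‖ with hM
    set κ := 2 * N * C with hκ
    refine norm_le_of_hasDerivAt_commutator
      (D := fun s => Φ.finDynamics V s A - Φ.finDynamics U s A)
      (B := fun s => ‖A‖ * (2 * N * S X * expIntegral κ s +
        2 * ((M * s) ^ (n + 1) / (n + 1).factorial)))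
      (B' := fun s => ‖A‖ * (2 * N * S X * Real.exp (κ * s) + 2 * (M * ((M * s) ^ n / n.factorial))))
      (fun s => isSelfAdjoint_sum _ fun Z _ =>
        isSelfAdjoint_conjExp (Φ.isSelfAdjoint_hamiltonian V) (Φ.isSelfAdjoint Z) s)
      (fun s => Φ.hasDerivAt_finDynamics_sub hUV hA s) (fun s => ?_) (fun s hs => ?_) ?_ ht
    · have hp : HasDerivAt (fun s : ℝ => (M * s) ^ (n + 1) / (n + 1).factorial)
          (M * ((M * s) ^ n / n.factorial)) s := by
        have h1 := (((hasDerivAt_id s).const_mul M).pow (n + 1)).div_const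
          ((n + 1).factorial : ℝ)
        refine h1.congr_deriv ?_
        have : (n.factorial : ℝ) ≠ 0 := by positivity
        rw [Nat.factorial_succ]
        push_cast
        simp only [id]
        field_simp
      exact (((hasDerivAt_expIntegral κ s).const_mul _).add (hp.const_mul 2)).const_mul _
    · rw [norm_smul, Complex.norm_I, one_mul]
      have hE : ∀ Z, ‖(Φ.finDynamics V s (Φ.toFun Z) - Φ.finDynamics U s (Φ.toFun Z)) *
          Φ.finDynamics U s A - Φ.finDynamics U s A *
            (Φ.finDynamics V s (Φ.toFun Z) - Φ.finDynamics U s (Φ.toFun Z))‖ ≤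
          2 * ‖A‖ * (2 * N * expIntegral κ s * (‖Φ.toFun Z‖ * S Z) +
            2 * ((M * s) ^ n / n.factorial) * ‖Φ.toFun Z‖) := fun Z => by
        have h1 := norm_commutator_le
          (Φ.finDynamics V s (Φ.toFun Z) - Φ.finDynamics U s (Φ.toFun Z)) (Φ.finDynamics U s A)
        rw [norm_finDynamics] at h1
        have h2 := ih (Φ.mem_localAlg Z) hs
        have h3 := mul_le_mul_of_nonneg_left h2 (mul_nonneg zero_le_two (_root_.norm_nonneg A))
        refine h1.trans (le_trans (le_of_eq ?_) (h3.trans (le_of_eq ?_))) <;> ring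
      have hE' : ∀ Z, ‖Φ.finDynamics V s (Φ.toFun Z) * Φ.finDynamics V s A -
          Φ.finDynamics V s A * Φ.finDynamics V s (Φ.toFun Z)‖ ≤ 2 * ‖A‖ * ‖Φ.toFun Z‖ := fun Z => by
        have h1 := norm_commutator_le (Φ.finDynamics V s (Φ.toFun Z)) (Φ.finDynamics V s A)
        rw [norm_finDynamics, norm_finDynamics] at h1
        linarith
      refine ((norm_add_le _ _).trans (add_le_add (norm_sum_le_of_le _ fun Z _ => hE Z)
        (norm_sum_le_of_le _ fun Z _ => hE' Z))).trans ?_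
      rw [← Finset.mul_sum, ← Finset.mul_sum, Finset.sum_add_distrib, ← Finset.mul_sum,
        ← Finset.mul_sum]
      have hM' : ∑ Z ∈ U.powerset with ¬ Disjoint Z X, ‖Φ.toFun Z‖ ≤ M / 2 := by
        rw [hM, mul_div_cancel_left₀ _ (two_ne_zero)]
        exact Finset.sum_le_sum_of_subset_of_nonneg
          ((Finset.filter_subset _ _).trans (Finset.powerset_mono.2 hUV))
          fun Z _ _ => _root_.norm_nonneg _
      have hM0 : 0 ≤ M := mul_nonneg zero_le_two (Finset.sum_nonneg fun Z _ => _root_.norm_nonneg _)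
      have h1 := mul_le_mul_of_nonneg_left (h.sum_norm_mul_sum_le (X := X) hUV (V \ U))
        (mul_nonneg (mul_nonneg zero_le_two hN) (expIntegral_nonneg κ hs))
      have h2 := mul_le_mul_of_nonneg_left hM'
        (show 0 ≤ 2 * ((M * s) ^ n / n.factorial) by positivity)
      have h3 := h.sum_norm_le (V := V) (U := U) (X := X)
      -- The S(X) terms combine to 2N‖A‖ S(X) (1 + κ · `expIntegral κ s`), which is 2N‖A‖ S(X)
      -- e^{κs}, exactly the derivative of the main term.
      calc _ ≤ 2 * ‖A‖ * (2 * N * expIntegral κ s * (N * (C * S X)) +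
            2 * ((M * s) ^ n / n.factorial) * (M / 2)) + 2 * ‖A‖ * (N * S X) := by
            gcongr
        _ = _ := by
            rw [← one_add_mul_expIntegral κ s, hκ]
            ring
    · simp [finDynamics_eq_conjExp, expIntegral]

theorem IsDominated.norm_finDynamics_sub_le_of_nonneg (h : Φ.IsDominated f N C) {V U : Finset Λ}
    (hUV : U ⊆ V) {X : Finset Λ} {A : Obs ι} (hA : A ∈ localAlg ι X) {t : ℝ} (ht : 0 ≤ t) :
    ‖Φ.finDynamics V t A - Φ.finDynamics U t A‖ ≤
      ‖A‖ * (2 * N * (∑ x ∈ X, ∑ y ∈ V \ U, f x y) * expIntegral (2 * N * C) t) := by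
  have hlim := ((FloorSemiring.tendsto_pow_div_factorial_atTop
    ((2 * ∑ Z ∈ V.powerset, ‖Φ.toFun Z‖) * t)).const_mul 2).const_add
      (2 * N * (∑ x ∈ X, ∑ y ∈ V \ U, f x y) * expIntegral (2 * N * C) t) |>.const_mul ‖A‖
  rw [mul_zero, add_zero] at hlim
  exact ge_of_tendsto' hlim fun n => h.norm_finDynamics_sub_le_aux hUV n hA ht

/-- Changing the sign of the interaction reverses time, which reduces negative times to positive
ones. -/
instance : Neg (Interaction ι) where
  neg Φ := ⟨fun X => -Φ.toFun X, fun X => neg_mem (Φ.mem_localAlg X),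
    fun X => (Φ.isSelfAdjoint X).neg⟩

theorem neg_toFun (Φ : Interaction ι) (X : Finset Λ) : (-Φ).toFun X = -Φ.toFun X := rfl

theorem finDynamics_neg (Φ : Interaction ι) (V : Finset Λ) (t : ℝ) (A : Obs ι) :
    (-Φ).finDynamics V t A = Φ.finDynamics V (-t) A := by
  rw [finDynamics_eq_conjExp, finDynamics_eq_conjExp, ← conjExp_neg]
  simp [hamiltonian, neg_toFun]

theorem IsDominated.neg (h : Φ.IsDominated f N C) : (-Φ).IsDominated f N C where
  nonneg := h.nonneg
  norm_nonneg := h.norm_nonneg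
  conv_nonneg := h.conv_nonneg
  sum_le x y s := by simpa only [neg_toFun, norm_neg] using h.sum_le x y s
  conv_le := h.conv_le

/-- Comparison of the dynamics of two nested finite volumes. -/
theorem IsDominated.norm_finDynamics_sub_le (h : Φ.IsDominated f N C) {V U : Finset Λ}
    (hUV : U ⊆ V) {X : Finset Λ} {A : Obs ι} (hA : A ∈ localAlg ι X) (t : ℝ) :
    ‖Φ.finDynamics V t A - Φ.finDynamics U t A‖ ≤
      ‖A‖ * (2 * N * (∑ x ∈ X, ∑ y ∈ V \ U, f x y) * expIntegral (2 * N * C) |t|) := by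
  rcases le_total 0 t with ht | ht
  · rw [abs_of_nonneg ht]
    exact h.norm_finDynamics_sub_le_of_nonneg hUV hA ht
  · rw [abs_of_nonpos ht]
    have := h.neg.norm_finDynamics_sub_le_of_nonneg hUV hA (neg_nonneg.2 ht)
    rwa [finDynamics_neg, finDynamics_neg, neg_neg] at this

end Interaction

end SpinLattice

end

/-! ### Weights, their tails, and distances. -/

noncomputable section

namespace SpinLattice

universe u v

section TsumBound

variable {α : Type*} {g : α → ℝ} {L : ℝ≥0∞}

theorem sum_le_toReal_of_tsum_le (hg : ∀ i, 0 ≤ g i) (h : ∑' i, ENNReal.ofReal (g i) ≤ L)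
    (hL : L < ∞) (s : Finset α) : ∑ i ∈ s, g i ≤ L.toReal := by
  rw [← ENNReal.ofReal_le_iff_le_toReal hL.ne, ENNReal.ofReal_sum_of_nonneg fun i _ => hg i]
  exact (ENNReal.sum_le_tsum s).trans h

theorem summable_of_tsum_ofReal_le (hg : ∀ i, 0 ≤ g i) (h : ∑' i, ENNReal.ofReal (g i) ≤ L)
    (hL : L < ∞) : Summable g :=
  summable_of_sum_le hg (sum_le_toReal_of_tsum_le hg h hL)

end TsumBound

section Weight

variable {Λ : Type u} [MetricSpace Λ] {F : ℝ → ℝ} {a : ℝ}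

theorem IsWeight.expWeight_pos (hF : IsWeight Λ F) (a : ℝ) (x y : Λ) :
    0 < expWeight F a (dist x y) :=
  mul_pos (Real.exp_pos _) (hF.pos _ dist_nonneg)

theorem IsWeight.weightNorm_expWeight_le (hF : IsWeight Λ F) (ha : 0 ≤ a) :
    weightNorm Λ (expWeight F a) ≤ weightNorm Λ F := by
  refine iSup_mono fun x => ENNReal.tsum_le_tsum fun y => ENNReal.ofReal_le_ofReal ?_
  refine mul_le_of_le_one_left (hF.pos _ dist_nonneg).le (Real.exp_le_one_iff.2 ?_)
  have := mul_nonneg ha (dist_nonneg (x := x) (y := y))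
  linarith

theorem IsWeight.weightConv_expWeight_le (hF : IsWeight Λ F) (ha : 0 ≤ a) :
    weightConv Λ (expWeight F a) ≤ weightConv Λ F := by
  refine iSup_mono fun x => iSup_mono fun y => ENNReal.tsum_le_tsum fun z =>
    ENNReal.ofReal_le_ofReal ?_
  have h1 := hF.pos _ (dist_nonneg (x := x) (y := z))
  have h2 := hF.pos _ (dist_nonneg (x := z) (y := y))
  have h3 := hF.pos _ (dist_nonneg (x := x) (y := y))
  rw [div_le_div_iff₀ (hF.expWeight_pos a x y) h3]
  -- By the triangle inequality the exponential factor only lowers the convolution quotient.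
  have he : Real.exp (-(a * dist x z)) * Real.exp (-(a * dist z y)) ≤
      Real.exp (-(a * dist x y)) := by
    rw [← Real.exp_add]
    refine Real.exp_le_exp.2 ?_
    have := mul_le_mul_of_nonneg_left (dist_triangle x z y) ha
    linarith
  have := mul_le_mul_of_nonneg_right he (mul_pos (mul_pos h1 h2) h3).le
  simp only [expWeight]
  linarith

theorem IsWeight.sum_expWeight_conv_le (hF : IsWeight Λ F) (ha : 0 ≤ a) (x y : Λ)
    (V : Finset Λ) :
    ∑ z ∈ V, expWeight F a (dist x z) * expWeight F a (dist z y) ≤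
      (weightConv Λ (expWeight F a)).toReal * expWeight F a (dist x y) := by
  have hp := hF.expWeight_pos a x y
  rw [← div_le_iff₀ hp, Finset.sum_div]
  refine sum_le_toReal_of_tsum_le
    (g := fun z => expWeight F a (dist x z) * expWeight F a (dist z y) / expWeight F a (dist x y))
    (fun z => ?_) (le_iSup₂_of_le x y le_rfl)
    ((hF.weightConv_expWeight_le ha).trans_lt hF.conv_lt_top) V
  exact div_nonneg (mul_nonneg (hF.expWeight_pos a x z).le (hF.expWeight_pos a z y).le) hp.le

theorem IsWeight.weightConv_expWeight_pos (hF : IsWeight Λ F) (ha : 0 ≤ a) (x : Λ) :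
    0 < (weightConv Λ (expWeight F a)).toReal := by
  have hp := hF.expWeight_pos a x x
  have := hF.sum_expWeight_conv_le ha x x {x}
  rw [Finset.sum_singleton] at this
  exact hp.trans_le (le_of_mul_le_mul_right this hp)

theorem IsWeight.summable_expWeight (hF : IsWeight Λ F) (ha : 0 ≤ a) (x : Λ) :
    Summable fun y => expWeight F a (dist x y) :=
  summable_of_tsum_ofReal_le (fun y => (hF.expWeight_pos a x y).le)
    (le_iSup (fun x => ∑' y : Λ, ENNReal.ofReal (expWeight F a (dist x y))) x)
    ((hF.weightNorm_expWeight_le ha).trans_lt hF.norm_lt_top)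

theorem IsWeight.sum_le_weightNorm (hF : IsWeight Λ F) (x : Λ) (s : Finset Λ) :
    ∑ y ∈ s, F (dist x y) ≤ (weightNorm Λ F).toReal :=
  sum_le_toReal_of_tsum_le (fun _ => (hF.pos _ dist_nonneg).le)
    (le_iSup (fun x => ∑' y : Λ, ENNReal.ofReal (F (dist x y))) x) hF.norm_lt_top s

/-- At distance at least r/2 the exponential factor is at most e^{-ar/2}; what remains sums to at
most ‖F‖. -/
theorem IsWeight.tsum_far_le (hF : IsWeight Λ F) (ha : 0 ≤ a) (x : Λ) (r : ℝ) :
    ∑' y : {y : Λ // r ≤ 2 * dist x y}, expWeight F a (dist x y.1) ≤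
      (weightNorm Λ F).toReal * Real.exp (-(a * r / 2)) := by
  refine Real.tsum_le_of_sum_le (fun y => (hF.expWeight_pos a x y.1).le) fun s => ?_
  calc ∑ y ∈ s, expWeight F a (dist x y.1)
      ≤ ∑ y ∈ s, F (dist x y.1) * Real.exp (-(a * r / 2)) := by
        refine Finset.sum_le_sum fun y _ => ?_
        rw [expWeight, mul_comm]
        refine mul_le_mul_of_nonneg_left (Real.exp_le_exp.2 ?_) (hF.pos _ dist_nonneg).le
        have := mul_le_mul_of_nonneg_left y.2 ha
        linarith
    _ = (∑ y ∈ s.map (Function.Embedding.subtype _), F (dist x y)) * Real.exp (-(a * r / 2)) := by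
        rw [Finset.sum_map, Finset.sum_mul]
        rfl
    _ ≤ _ := mul_le_mul_of_nonneg_right (hF.sum_le_weightNorm x _) (Real.exp_pos _).le

theorem IsWeight.sum_far_le_tsum (hF : IsWeight Λ F) (ha : 0 ≤ a) (x : Λ) (r : ℝ) (s : Finset Λ)
    (hs : ∀ y ∈ s, r ≤ 2 * dist x y) :
    ∑ y ∈ s, expWeight F a (dist x y) ≤
      ∑' y : {y : Λ // r ≤ 2 * dist x y}, expWeight F a (dist x y.1) := by
  classical
  rw [← Finset.sum_subtype_of_mem (p := fun y => r ≤ 2 * dist x y) _ hs]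
  exact ((hF.summable_expWeight ha x).subtype {y | r ≤ 2 * dist x y}).sum_le_tsum _
    fun y _ => (hF.expWeight_pos a x y.1).le

theorem tsum_far_comm (f : ℝ → ℝ) (y : Λ) (r : ℝ) :
    ∑' x : {x : Λ // r ≤ 2 * dist x y}, f (dist x.1 y) =
      ∑' x : {x : Λ // r ≤ 2 * dist y x}, f (dist y x.1) := by
  rw [← Equiv.tsum_eq (Equiv.subtypeEquivRight fun x => by rw [dist_comm])]
  exact tsum_congr fun x => by simp [dist_comm]

theorem setDist_le {X Y : Finset Λ} {x y : Λ} (hx : x ∈ X) (hy : y ∈ Y) :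
    setDist X Y ≤ dist x y :=
  csInf_le ⟨0, by rintro _ ⟨_, _, _, _, rfl⟩; exact dist_nonneg⟩ ⟨x, hx, y, hy, rfl⟩

/-- The infimum of the empty set is 0 by convention. A point of the lattice is needed to know that
C_a is positive. -/
theorem nonempty_of_setDist_pos {X Y : Finset Λ} (h : 0 < setDist X Y) : Nonempty Λ := by
  by_contra hn
  rw [not_nonempty_iff] at hn
  have : {r : ℝ | ∃ x ∈ X, ∃ y ∈ Y, r = dist x y} = ∅ :=
    Set.eq_empty_of_forall_notMem fun r ⟨x, _⟩ => hn.elim x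
  rw [setDist, this, Real.sInf_empty] at h
  exact h.false

end Weight

variable {Λ : Type u} {ι : Λ → Type v} [DecidableEq Λ] [MetricSpace Λ]
  [∀ x, Fintype (ι x)] [∀ x, DecidableEq (ι x)] {F : ℝ → ℝ} {a : ℝ} {Φ : Interaction ι}

/-! ### Infinite-volume limit and correlations in finite volume. -/

namespace Interaction

theorem isDominated (hF : IsWeight Λ F) (ha : 0 ≤ a) (hΦ : Φ.decayNorm F a < ∞) :
    Φ.IsDominated (fun x y => expWeight F a (dist x y)) (Φ.decayNorm F a).toReal
      (weightConv Λ (expWeight F a)).toReal where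
  nonneg x y := (hF.expWeight_pos a x y).le
  norm_nonneg := ENNReal.toReal_nonneg
  conv_nonneg := ENNReal.toReal_nonneg
  sum_le x y s := by
    have hp := hF.expWeight_pos a x y
    rw [← Finset.sum_subtype_eq_sum_filter, ← div_le_iff₀ hp, Finset.sum_div]
    exact sum_le_toReal_of_tsum_le
      (g := fun X : {X : Finset Λ // x ∈ X ∧ y ∈ X} =>
        ‖Φ.toFun X.1‖ / expWeight F a (dist x y))
      (fun X => div_nonneg (norm_nonneg _) hp.le) (le_iSup₂_of_le x y le_rfl) hΦ _
  conv_le x y V := hF.sum_expWeight_conv_le ha x y V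

/-- The comparison estimate does not produce the prefactor (C_a + ‖F_a‖)/C_a; it is at least 1, so
including it only weakens the bound. -/
theorem decayNorm_mul_expIntegral_le_growth (hF : IsWeight Λ F) (ha : 0 ≤ a) (x : Λ) (t : ℝ) :
    (Φ.decayNorm F a).toReal *
      expIntegral (2 * (Φ.decayNorm F a).toReal * (weightConv Λ (expWeight F a)).toReal) |t| ≤
      Φ.growth F a t := by
  have hC := hF.weightConv_expWeight_pos ha x
  have h1 : (1 : ℝ) ≤ ((weightConv Λ (expWeight F a)).toReal +
      (weightNorm Λ (expWeight F a)).toReal) / (weightConv Λ (expWeight F a)).toReal := by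
    rw [one_le_div hC]
    exact le_add_of_nonneg_right ENNReal.toReal_nonneg
  have h2 := expIntegral_nonneg
    (2 * (Φ.decayNorm F a).toReal * (weightConv Λ (expWeight F a)).toReal) (abs_nonneg t)
  have h3 := le_mul_of_one_le_left
    (mul_nonneg (ENNReal.toReal_nonneg (a := Φ.decayNorm F a)) h2) h1
  rwa [← mul_assoc] at h3

theorem cauchy_finDynamics_of_mem_localAlg (hF : IsWeight Λ F) (ha : 0 ≤ a)
    (hΦ : Φ.decayNorm F a < ∞) (t : ℝ) {X : Finset Λ} {A : Obs ι} (hA : A ∈ localAlg ι X)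
    {ε : ℝ} (hε : 0 < ε) :
    ∃ U : Finset Λ, ∀ V, U ⊆ V → ‖Φ.finDynamics V t A - Φ.finDynamics U t A‖ < ε := by
  set N := (Φ.decayNorm F a).toReal
  set κ := 2 * N * (weightConv Λ (expWeight F a)).toReal
  set K := ‖A‖ * (2 * N * expIntegral κ |t|)
  have hK : 0 ≤ K := mul_nonneg (norm_nonneg _) (mul_nonneg (mul_nonneg zero_le_two
    ENNReal.toReal_nonneg) (expIntegral_nonneg κ (abs_nonneg t)))
  have hs : Summable fun y => ∑ x ∈ X, expWeight F a (dist x y) :=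
    summable_sum fun x _ => hF.summable_expWeight ha x
  -- The added 1 avoids a separate case for K = 0.
  have hδ : 0 < ε / (K + 1) := by positivity
  obtain ⟨U, hU⟩ := summable_iff_vanishing_norm.1 hs _ hδ
  refine ⟨U, fun V hUV => ?_⟩
  have h1 := (isDominated hF ha hΦ).norm_finDynamics_sub_le hUV hA t
  have h2 := (le_abs_self _).trans_lt (hU (V \ U) Finset.sdiff_disjoint)
  rw [Finset.sum_comm] at h2
  rw [lt_div_iff₀ (by positivity)] at h2
  have h3 : 0 ≤ ∑ x ∈ X, ∑ y ∈ V \ U, expWeight F a (dist x y) :=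
    Finset.sum_nonneg fun x _ => Finset.sum_nonneg fun y _ => (hF.expWeight_pos a x y).le
  refine (h1.trans (le_of_eq ?_)).trans_lt
    ((mul_le_mul_of_nonneg_left (le_add_of_nonneg_right zero_le_one) h3).trans_lt h2)
  ring

theorem tendsto_finDynamics (hF : IsWeight Λ F) (ha : 0 ≤ a) (hΦ : Φ.decayNorm F a < ∞) (t : ℝ)
    (O : Obs ι) :
    Tendsto (fun V : Finset Λ => Φ.finDynamics V t O) atTop (𝓝 (Φ.dynamics t O)) := by
  refine tendsto_nhds_limUnder (cauchySeq_tendsto_of_complete ?_)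
  refine Metric.cauchySeq_iff'.2 fun ε hε => ?_
  obtain ⟨X, A, hA, hOA⟩ := exists_localAlg_norm_sub_lt O (show 0 < ε / 3 by positivity)
  obtain ⟨U, hU⟩ := cauchy_finDynamics_of_mem_localAlg hF ha hΦ t hA (show 0 < ε / 3 by positivity)
  refine ⟨U, fun V hV => ?_⟩
  have h1 := hU V hV
  have h2 : ∀ W, ‖Φ.finDynamics W t O - Φ.finDynamics W t A‖ < ε / 3 := fun W => by
    rwa [← finDynamics_sub, norm_finDynamics]
  rw [dist_eq_norm]
  have e : Φ.finDynamics V t O - Φ.finDynamics U t O =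
      (Φ.finDynamics V t O - Φ.finDynamics V t A) + (Φ.finDynamics V t A - Φ.finDynamics U t A) -
        (Φ.finDynamics U t O - Φ.finDynamics U t A) := by abel
  rw [e]
  have h3 := norm_sub_le ((Φ.finDynamics V t O - Φ.finDynamics V t A) +
    (Φ.finDynamics V t A - Φ.finDynamics U t A)) (Φ.finDynamics U t O - Φ.finDynamics U t A)
  have h4 := norm_add_le (Φ.finDynamics V t O - Φ.finDynamics V t A)
    (Φ.finDynamics V t A - Φ.finDynamics U t A)
  have := h2 V
  have := h2 U
  linarith

omit [MetricSpace Λ] in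
-- The local algebra is finite-dimensional, hence closed, and so contains the limit of the
-- exponential series of its elements.
theorem finDynamics_mem_localAlg (Φ : Interaction ι) {V X : Finset Λ} (hXV : X ⊆ V) {A : Obs ι}
    (hA : A ∈ localAlg ι X) (t : ℝ) : Φ.finDynamics V t A ∈ localAlg ι V := by
  have hfin : FiniteDimensional ℂ (localAlg ι V).toSubalgebra.toSubmodule :=
    inferInstanceAs (FiniteDimensional ℂ (LinearMap.range (embed (ι := ι) V).toLinearMap))
  have hexp : ∀ B ∈ localAlg ι V, NormedSpace.exp B ∈ localAlg ι V := fun B hB => by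
    refine (localAlg ι V).toSubalgebra.toSubmodule.closed_of_finiteDimensional.mem_of_tendsto
      (NormedSpace.exp_series_hasSum_exp' (𝕂 := ℂ) B) (Eventually.of_forall fun s => ?_)
    exact sum_mem fun n _ => SMulMemClass.smul_mem _ (pow_mem hB n)
  have hH := SMulMemClass.smul_mem (Complex.I * (t : ℂ)) (Φ.hamiltonian_mem_localAlg V)
  exact mul_mem (mul_mem (hexp _ hH) (localAlg_mono hXV hA)) (hexp _ (neg_mem hH))

omit [MetricSpace Λ] in
theorem norm_correlation_le_of_factor {ω : Obs ι →ₗ[ℂ] ℂ} (hω : IsState ω) {A B A' B' : Obs ι}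
    {α β : ℝ} (hA : ‖A - A'‖ ≤ α) (hB : ‖B - B'‖ ≤ β) (hA' : ‖A'‖ = ‖A‖)
    (h : ω (A' * B') = ω A' * ω B') :
    ‖ω (A * B) - ω A * ω B‖ ≤ 2 * (α * ‖B‖ + ‖A‖ * β) := by
  have e : ω (A * B) - ω A * ω B = ω ((A - A') * B) + ω (A' * (B - B')) -
      (ω (A - A') * ω B + ω A' * ω (B - B')) := by
    simp only [sub_mul, mul_sub, map_sub, h]
    ring
  have h1 : ‖ω ((A - A') * B)‖ ≤ α * ‖B‖ := (hω.norm_apply_le _).trans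
    ((norm_mul_le _ _).trans (mul_le_mul_of_nonneg_right hA (norm_nonneg _)))
  have h2 : ‖ω (A' * (B - B'))‖ ≤ ‖A‖ * β := (hω.norm_apply_le _).trans
    ((norm_mul_le _ _).trans (by rw [hA']; exact mul_le_mul_of_nonneg_left hB (norm_nonneg _)))
  have h3 : ‖ω (A - A') * ω B‖ ≤ α * ‖B‖ := by
    rw [norm_mul]
    exact mul_le_mul ((hω.norm_apply_le _).trans hA) (hω.norm_apply_le _) (norm_nonneg _)
      ((norm_nonneg _).trans hA)
  have h4 : ‖ω A' * ω (B - B')‖ ≤ ‖A‖ * β := by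
    rw [norm_mul]
    exact mul_le_mul ((hω.norm_apply_le _).trans hA'.le) ((hω.norm_apply_le _).trans hB)
      (norm_nonneg _) (norm_nonneg _)
  rw [e]
  have h5 := norm_sub_le (ω ((A - A') * B) + ω (A' * (B - B')))
    (ω (A - A') * ω B + ω A' * ω (B - B'))
  have h6 := norm_add_le (ω ((A - A') * B)) (ω (A' * (B - B')))
  have h7 := norm_add_le (ω (A - A') * ω B) (ω A' * ω (B - B'))
  linarith

theorem norm_correlation_finDynamics_le (hF : IsWeight Λ F) (ha : 0 ≤ a)
    (hΦ : Φ.decayNorm F a < ∞) {Ω : (x : Λ) → Matrix (ι x) (ι x) ℂ →ₗ[ℂ] ℂ}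
    {ω : Obs ι →ₗ[ℂ] ℂ} (hω : IsProductState Ω ω) {X Y : Finset Λ} (hXY : 0 < setDist X Y)
    {A B : Obs ι} (hA : A ∈ localAlg ι X) (hB : B ∈ localAlg ι Y) (t : ℝ) {V : Finset Λ}
    (hV : X ∪ Y ⊆ V) :
    ‖ω (Φ.finDynamics V t (A * B)) - ω (Φ.finDynamics V t A) * ω (Φ.finDynamics V t B)‖ ≤
      4 * ‖A‖ * ‖B‖ * Φ.growth F a t *
        ((∑ x ∈ X, ∑' y : {y : Λ // setDist X Y ≤ 2 * dist x y}, expWeight F a (dist x y.1)) +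
          ∑ y ∈ Y, ∑' x : {x : Λ // setDist X Y ≤ 2 * dist x y}, expWeight F a (dist x.1 y)) := by
  classical
  obtain ⟨x₀⟩ := nonempty_of_setDist_pos hXY
  set d := setDist X Y
  set N := (Φ.decayNorm F a).toReal
  set κ := 2 * N * (weightConv Λ (expWeight F a)).toReal
  -- The strict inequality puts the points at exactly d/2 outside U, matching the closed condition
  -- in the tail sums.
  set U := {z ∈ V | ∃ x ∈ X, 2 * dist x z < d} with hU
  have hUV : U ⊆ V := Finset.filter_subset _ _
  have hXU : X ⊆ U := fun x hx => Finset.mem_filter.2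
    ⟨hV (Finset.mem_union_left _ hx), x, hx, by simpa using hXY⟩
  have hYU : Y ⊆ V \ U := fun y hy => by
    refine Finset.mem_sdiff.2 ⟨hV (Finset.mem_union_right _ hy), fun h => ?_⟩
    obtain ⟨x, hx, hxy⟩ := (Finset.mem_filter.1 h).2
    have := setDist_le hx hy
    linarith
  have hD := isDominated hF ha hΦ
  have hA' := hD.norm_finDynamics_sub_le hUV hA t
  have hB' := hD.norm_finDynamics_sub_le (Finset.sdiff_subset (s := V) (t := U)) hB t
  have hfac := hω.map_mul Finset.disjoint_sdiff (Φ.finDynamics_mem_localAlg hXU hA t)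
    (Φ.finDynamics_mem_localAlg hYU hB t)
  have hmain := norm_correlation_le_of_factor hω.2.1 hA' hB'
    (by rw [norm_finDynamics, norm_finDynamics]) hfac
  rw [norm_finDynamics, norm_finDynamics, ← finDynamics_mul] at hmain
  have hSX : ∑ x ∈ X, ∑ y ∈ V \ U, expWeight F a (dist x y) ≤
      ∑ x ∈ X, ∑' y : {y : Λ // d ≤ 2 * dist x y}, expWeight F a (dist x y.1) := by
    refine Finset.sum_le_sum fun x hx => hF.sum_far_le_tsum ha x d _ fun y hy => ?_
    rw [Finset.mem_sdiff] at hy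
    by_contra! h
    exact hy.2 (Finset.mem_filter.2 ⟨hy.1, x, hx, h⟩)
  have hSY : ∑ y ∈ Y, ∑ x ∈ V \ (V \ U), expWeight F a (dist y x) ≤
      ∑ y ∈ Y, ∑' x : {x : Λ // d ≤ 2 * dist x y}, expWeight F a (dist x.1 y) := by
    refine Finset.sum_le_sum fun y hy => ?_
    rw [tsum_far_comm]
    refine hF.sum_far_le_tsum ha y d _ fun z hz => ?_
    -- For B the discarded region is U itself: its points are within d/2 of X, hence farther than
    -- d/2 from Y by the triangle inequality.
    rw [Finset.sdiff_sdiff_eq_self hUV] at hz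
    obtain ⟨x, hx, hxz⟩ := (Finset.mem_filter.1 hz).2
    have h1 := setDist_le hx hy
    have h2 := dist_triangle x z y
    rw [dist_comm z y] at h2
    linarith
  have hG := decayNorm_mul_expIntegral_le_growth (Φ := Φ) hF ha x₀ t
  have hG0 : 0 ≤ N * expIntegral κ |t| :=
    mul_nonneg ENNReal.toReal_nonneg (expIntegral_nonneg κ (abs_nonneg t))
  have hS := add_le_add hSX hSY
  have hS0 : 0 ≤ ∑ x ∈ X, ∑ y ∈ V \ U, expWeight F a (dist x y) +
      ∑ y ∈ Y, ∑ x ∈ V \ (V \ U), expWeight F a (dist y x) :=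
    add_nonneg (Finset.sum_nonneg fun x _ => Finset.sum_nonneg fun y _ => (hF.expWeight_pos a x y).le)
      (Finset.sum_nonneg fun x _ => Finset.sum_nonneg fun y _ => (hF.expWeight_pos a x y).le)
  have hP := mul_le_mul_of_nonneg_left (mul_le_mul hG hS hS0 (hG0.trans hG))
    (show 0 ≤ 4 * ‖A‖ * ‖B‖ by positivity)
  refine hmain.trans (le_trans (le_of_eq ?_) (hP.trans (le_of_eq ?_))) <;> ring

end Interaction

end SpinLattice

end

/-! ### Passage to the infinite-volume limit. -/

open SpinLattice Filter Topology in
theorem theorem3p1 {Λ : Type*} [MetricSpace Λ] [DecidableEq Λ]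
    {ι : Λ → Type*} [∀ x, Fintype (ι x)] [∀ x, DecidableEq (ι x)] [∀ x, Nonempty (ι x)]
    (F : ℝ → ℝ) (hF : IsWeight Λ F) (a : ℝ) (ha : 0 ≤ a)
    (Φ : Interaction ι) (hΦ : Φ.decayNorm F a < ⊤)
    (Ω : (x : Λ) → Matrix (ι x) (ι x) ℂ →ₗ[ℂ] ℂ) (ω : Obs ι →ₗ[ℂ] ℂ)
    (hω : IsProductState Ω ω) :
    (∀ (t : ℝ) (O : Obs ι),
      Tendsto (fun V : Finset Λ => Φ.finDynamics V t O) atTop (𝓝 (Φ.dynamics t O))) ∧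
    ∀ (X Y : Finset Λ), 0 < setDist X Y →
      ∀ A ∈ localAlg ι X, ∀ B ∈ localAlg ι Y, ∀ t : ℝ,
        ‖ω (Φ.dynamics t (A * B)) - ω (Φ.dynamics t A) * ω (Φ.dynamics t B)‖ ≤
            4 * ‖A‖ * ‖B‖ * Φ.growth F a t *
              ((∑ x ∈ X, ∑' y : {y : Λ // setDist X Y ≤ 2 * dist x y},
                  expWeight F a (dist x y.1)) +
                ∑ y ∈ Y, ∑' x : {x : Λ // setDist X Y ≤ 2 * dist x y},
                  expWeight F a (dist x.1 y)) ∧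
        ‖ω (Φ.dynamics t (A * B)) - ω (Φ.dynamics t A) * ω (Φ.dynamics t B)‖ ≤
            4 * ‖A‖ * ‖B‖ * (weightNorm Λ F).toReal * ((X.card : ℝ) + (Y.card : ℝ)) *
              Φ.growth F a t * Real.exp (-(a * setDist X Y / 2)) := by
  have hlim := fun t O => Interaction.tendsto_finDynamics hF ha hΦ t O
  refine ⟨hlim, fun X Y hXY A hA B hB t => ?_⟩
  have hωc : Continuous ω :=
    AddMonoidHomClass.continuous_of_bound ω 1 fun A => by
      rw [one_mul]
      exact hω.2.1.norm_apply_le A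
  have hω' := fun O => (hωc.tendsto _).comp (hlim t O)
  -- The finite-volume bound is uniform in V ⊇ X ∪ Y and ω is norm continuous, so the bound survives
  -- the limit.
  have h1 := le_of_tendsto ((hω' (A * B)).sub ((hω' A).mul (hω' B))).norm
    ((eventually_ge_atTop (X ∪ Y)).mono fun V hV =>
      Interaction.norm_correlation_finDynamics_le hF ha hΦ hω hXY hA hB t hV)
  refine ⟨h1, h1.trans ?_⟩
  obtain ⟨x₀⟩ := nonempty_of_setDist_pos hXY
  have hG0 : 0 ≤ Φ.growth F a t :=
    (mul_nonneg ENNReal.toReal_nonneg (expIntegral_nonneg _ (abs_nonneg t))).trans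
      (Interaction.decayNorm_mul_expIntegral_le_growth hF ha x₀ t)
  have hX := Finset.sum_le_card_nsmul X _ _ fun x _ => hF.tsum_far_le ha x (setDist X Y)
  have hY := Finset.sum_le_card_nsmul Y _ _ fun y _ => hF.tsum_far_le ha y (setDist X Y)
  simp only [nsmul_eq_mul] at hX hY
  simp only [← tsum_far_comm (expWeight F a)] at hY
  refine (mul_le_mul_of_nonneg_left (add_le_add hX hY) (by positivity)).trans (le_of_eq ?_)
  ring
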